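/- **Conventions.** A loop is a set $Q$ with a binary operation and a neutral element $1$ such that all translations $L_x(y)=xy$ and $R_x(y)=yx$ are permutations of $Q$; it is Moufang if $xy\cdot zx=(x\cdot yz)x$ for all $x,y,z$, and $3$-divisible if every element of $Q$ is a cube. Put $T_a=R_a^{-1}L_a$. A subloop is normal if it is invariant under all inner mappings, i.e. under all elements of $\langle L_x,R_x:x\in Q\rangle$ that fix $1$. For $i,j\in\mathbb Z$ let $I(i,j)=\{\min(i,j),\dots,\max(i,j)-1\}$ (empty if $i=j$). Let $(X,+)$ be an abelian group. A mapping $\gamma:X\times X\to X$ is symmetric if $\gamma(x,y)=\gamma(y,x)$, alternating if $\gamma(x,x)=0$, and biadditive if it is additive in each variable. Let $\mathrm{Rad}(\gamma)=\{x:\gamma(x,y)=0\text{ for all }y\}$. * For a permutation $f$ of $X$ put $\beta(x,y)=f^{-1}(f(x)+f(y))-x-y$. Then $f$ is a Moufang permutation, with associated mapping $\beta$, if $\beta$ is symmetric, alternating and biadditive, $\beta(\beta(x,y),z)=0$ and $\beta(f(x),f(y))=f(\beta(f^3(x),y))$ for all $x,y,z\in X$. * For a permutation $g$ of $X$ and $\gamma:X\times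 X\to X$, the pair $(g,\gamma)$ is a construction pair if $\gamma$ is symmetric, alternating and biadditive and, for all $x,y,z\in X$, $g^{-1}(g(x)+g(y))=x+y+\gamma(x,y)+g^{-1}(\gamma(x,y))+g^{-2}(\gamma(x,y))$, $\gamma(\gamma(x,y),z)=0$ and $g^{-1}(\gamma(x,y))=\gamma(g(x),y)$. * Let $r(g,\gamma)$ be the least $r\ge 1$ with $\sum_{0\le k<r}g^k(x)\in\mathrm{Rad}(\gamma)$ for all $x\in X$, or $\infty$ if there is none. A construction pair $(g,\gamma)$ is admissible for a cyclic group $C=\langle b\rangle$ if $C$ is infinite, or $C$ is finite and both the order $|g|$ and $r(g,\gamma)$ divide $|C|$ (in particular they are finite). Then $C\ltimes_{(g,\gamma)}X$ denotes $C\times X$ with the multiplication $$(b^i,x)\cdot(b^j,y)=\Big(b^{i+j},\;g^{-j}(x)+y+\sum_{k\in I(i+j,-j)}g^{-k}(\gamma(x,y))\Big)\qquad(i,j\in\mathbb Z,\ x,y\in X).$$ **Theorem 8.4.** Let $Q$ be a $3$-divisible Moufang loop, $X$ a normal subloop of $Q$ that is an abelian group (with the operation of $Q$ on $X$ written as $+$),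 and $a\in Q$ an element such that $a\in C:=\langle a^3\rangle$ and $Q=CX$. Let $f$ be the restriction of $T_a$ to $X$. Then $f$ is a Moufang permutation on $(X,+)$. Let $\beta$ be its associated mapping. Then: 1. $(f^3,\beta)$ is a construction pair that is admissible for the cyclic group $C=\langle a^3\rangle$, and $M=\langle a^3\rangle\ltimes_{(f^3,\beta)}X$ is a well defined Moufang loop: the value of the multiplication formula (with $b=a^3$) does not depend on the choice of the exponents $i,j$. 2. $\varphi:M\to Q$, $\varphi(a^{3i},x)=a^{3i}x$, is a well defined surjective homomorphism. 3. The kernel of $\varphi$ (the preimage of $1$) intersects both $C\times 0$ and $1\times X$ trivially. -/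

import Mathlib

namespace Moufang

/-- Loops: a neutral element, and all left and right translations are permutations. -/
class IsLoop (Q : Type*) [Mul Q] [One Q] : Prop where
  one_mul' : ∀ x : Q, 1 * x = x
  mul_one' : ∀ x : Q, x * 1 = x
  left_bijective : ∀ x : Q, Function.Bijective (fun y : Q => x * y)
  right_bijective : ∀ x : Q, Function.Bijective (fun y : Q => y * x)

/-- Moufang loops. -/
class IsMoufangLoop (Q : Type*) [Mul Q] [One Q] : Prop extends IsLoop Q where
  moufang : ∀ x y z : Q, (x * y) * (z * x) = (x * (y * z)) * x

section Loops

variable {Q : Type*} [Mul Q] [One Q]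

/-- The left translation `L_x : y ↦ x * y`. -/
noncomputable def leftTr [IsLoop Q] (x : Q) : Equiv.Perm Q :=
  Equiv.ofBijective (fun y => x * y) (IsLoop.left_bijective x)

/-- The right translation `R_x : y ↦ y * x`. -/
noncomputable def rightTr [IsLoop Q] (x : Q) : Equiv.Perm Q :=
  Equiv.ofBijective (fun y => y * x) (IsLoop.right_bijective x)

/-- The conjugation `T_x = R_x⁻¹ L_x`. -/
noncomputable def conjMap [IsLoop Q] (x : Q) : Equiv.Perm Q := (rightTr x)⁻¹ * leftTr x

/-- The multiplication group, generated by all translations. -/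
def multGroup (Q : Type*) [Mul Q] [One Q] [IsLoop Q] : Subgroup (Equiv.Perm Q) :=
  Subgroup.closure (Set.range (leftTr (Q := Q)) ∪ Set.range (rightTr (Q := Q)))

/-- Integer powers: `a ^ i = L_a ^ i (1)`, that is `a ^ (i + 1) = a * a ^ i` and `a ^ 0 = 1`.
In a power associative loop (such as a Moufang loop) these are the usual powers. -/
noncomputable def lpow [IsLoop Q] (a : Q) (i : ℤ) : Q := (leftTr a ^ i) 1

/-- A loop is 3-divisible if every element is a cube. -/
def ThreeDivisible (Q : Type*) [Mul Q] [One Q] [IsLoop Q] : Prop :=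
  ∀ x : Q, ∃ y : Q, lpow y 3 = x

end Loops

/-- Subloops: subsets that contain `1` and are closed under multiplication and both divisions
`x \ y = L_x⁻¹ y` and `y / x = R_x⁻¹ y`. -/
structure Subloop (Q : Type*) [Mul Q] [One Q] [IsLoop Q] where
  carrier : Set Q
  one_mem : 1 ∈ carrier
  mul_mem : ∀ {x y : Q}, x ∈ carrier → y ∈ carrier → x * y ∈ carrier
  ldiv_mem : ∀ {x y : Q}, x ∈ carrier → y ∈ carrier → (leftTr x).symm y ∈ carrier
  rdiv_mem : ∀ {x y : Q}, x ∈ carrier → y ∈ carrier → (rightTr x).symm y ∈ carrier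

instance (Q : Type*) [Mul Q] [One Q] [IsLoop Q] : SetLike (Subloop Q) Q where
  coe := Subloop.carrier
  coe_injective := fun S T h => by cases S; cases T; congr

/-- Abelian subgroups of a loop: associative and commutative subloops. -/
structure AbelianSubgroup (Q : Type*) [Mul Q] [One Q] [IsLoop Q] extends Subloop Q where
  assoc : ∀ {x y z : Q}, x ∈ carrier → y ∈ carrier → z ∈ carrier → (x * y) * z = x * (y * z)
  comm : ∀ {x y : Q}, x ∈ carrier → y ∈ carrier → x * y = y * x

instance (Q : Type*) [Mul Q] [One Q] [IsLoop Q] : SetLike (AbelianSubgroup Q) Q where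
  coe := fun X => X.carrier
  coe_injective := fun S T h => by
    obtain ⟨⟨_, _, _, _, _⟩, _, _⟩ := S
    obtain ⟨⟨_, _, _, _, _⟩, _, _⟩ := T
    congr

section Subloops

variable {Q : Type*} [Mul Q] [One Q]

/-- A subloop is normal if it is invariant under the inner mapping group, which is the stabilizer
of `1` in the multiplication group. -/
def Subloop.IsNormal [IsLoop Q] (S : Subloop Q) : Prop :=
  ∀ φ ∈ multGroup Q, φ 1 = 1 → ∀ x ∈ S, φ x ∈ S

/-- The subloop `⟨b⟩` generated by `b`: the intersection of all subloops that contain `b`. -/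
def cyclicSubloop [IsLoop Q] (b : Q) : Subloop Q where
  carrier := {x | ∀ S : Subloop Q, b ∈ S → x ∈ S}
  one_mem := fun S _ => S.one_mem
  mul_mem := fun hx hy S hS => S.mul_mem (hx S hS) (hy S hS)
  ldiv_mem := fun hx hy S hS => S.ldiv_mem (hx S hS) (hy S hS)
  rdiv_mem := fun hx hy S hS => S.rdiv_mem (hx S hS) (hy S hS)

/-- The generator `b` of `⟨b⟩`. -/
def cyclicGen [IsLoop Q] (b : Q) : cyclicSubloop b := ⟨b, fun _ hS => hS⟩

theorem mul_ldiv [IsLoop Q] (x y : Q) : x * (leftTr x).symm y = y :=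
  (leftTr x).apply_symm_apply y

/-- An abelian subgroup of a loop, written additively: `x + y` is the product in the loop. -/
noncomputable instance [IsLoop Q] (X : AbelianSubgroup Q) : AddCommGroup X where
  add x y := ⟨(x : Q) * y, X.mul_mem x.2 y.2⟩
  zero := ⟨1, X.one_mem⟩
  nsmul := @nsmulRec X ⟨⟨1, X.one_mem⟩⟩ ⟨fun x y => ⟨(x : Q) * y, X.mul_mem x.2 y.2⟩⟩
  neg x := ⟨(leftTr (x : Q)).symm 1, X.ldiv_mem x.2 X.one_mem⟩
  add_assoc x y z := Subtype.ext (X.assoc x.2 y.2 z.2)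
  zero_add x := Subtype.ext (IsLoop.one_mul' (x : Q))
  add_zero x := Subtype.ext (IsLoop.mul_one' (x : Q))
  add_comm x y := Subtype.ext (X.comm x.2 y.2)
  neg_add_cancel x := Subtype.ext
    ((X.comm (X.ldiv_mem x.2 X.one_mem) x.2).trans (mul_ldiv (x : Q) 1))
  zsmul := @zsmulRec X ⟨⟨1, X.one_mem⟩⟩ ⟨fun x y => ⟨(x : Q) * y, X.mul_mem x.2 y.2⟩⟩
    ⟨fun x => ⟨(leftTr (x : Q)).symm 1, X.ldiv_mem x.2 X.one_mem⟩⟩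
    (@nsmulRec X ⟨⟨1, X.one_mem⟩⟩ ⟨fun x y => ⟨(x : Q) * y, X.mul_mem x.2 y.2⟩⟩)

theorem loop_left_cancel [IsLoop Q] {x y z : Q} (h : x * y = x * z) : y = z :=
  (IsLoop.left_bijective x).1 h

theorem loop_right_cancel [IsLoop Q] {x y z : Q} (h : y * x = z * x) : y = z :=
  (IsLoop.right_bijective x).1 h

theorem loop_flexible [IsMoufangLoop Q] (x z : Q) : x * (z * x) = (x * z) * x := by
  have h := IsMoufangLoop.moufang x 1 z
  rwa [IsLoop.mul_one', IsLoop.one_mul'] at h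

theorem loop_mul_inv_mul [IsMoufangLoop Q] {x u : Q} (hu : x * u = 1) (z : Q) :
    x * (u * z) = z := by
  have h := IsMoufangLoop.moufang x u z
  rw [hu, IsLoop.one_mul'] at h
  exact (loop_right_cancel h).symm

theorem loop_inv_mul [IsMoufangLoop Q] {x u : Q} (hu : x * u = 1) : u * x = 1 := by
  apply loop_left_cancel (x := x)
  rw [loop_mul_inv_mul hu, IsLoop.mul_one']

theorem loop_mul_mul_inv [IsMoufangLoop Q] {x u : Q} (hu : u * x = 1) (y : Q) :
    (y * u) * x = y := by
  have h := IsMoufangLoop.moufang x y u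
  rw [hu, IsLoop.mul_one', ← loop_flexible] at h
  exact (loop_left_cancel h).symm

theorem loop_exists_inv [IsLoop Q] (x : Q) : ∃ u, x * u = 1 := ⟨_, mul_ldiv x 1⟩

theorem loop_inv_mul_rev [IsMoufangLoop Q] {x y u v : Q} (hu : x * u = 1) (hv : y * v = 1) :
    (x * y) * (v * u) = 1 := by
  obtain ⟨w, hw⟩ := loop_exists_inv (x * y)
  have h1 : y * w = u := by
    have h2 : u * (x * y) = y := loop_mul_inv_mul (loop_inv_mul hu) y
    rw [← h2]
    exact loop_mul_mul_inv hw u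
  have h2 : w = v * u := by
    rw [← h1]
    exact (loop_mul_inv_mul (loop_inv_mul hv) w).symm
  rw [← h2, hw]

theorem leftTr_conj [IsMoufangLoop Q] (x y z : Q) : x * (y * (x * z)) = (x * (y * x)) * z := by
  obtain ⟨u, hu⟩ := loop_exists_inv (x * z)
  obtain ⟨v, hv⟩ := loop_exists_inv z
  obtain ⟨w, hw⟩ := loop_exists_inv x
  have h1 : u * x = v := by
    have : u = v * w := by
      apply loop_left_cancel (x := x * z)
      rw [hu, loop_inv_mul_rev hw hv]
    rw [this]
    exact loop_mul_mul_inv (loop_inv_mul hw) v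
  have h := IsMoufangLoop.moufang x (y * (x * z)) u
  rw [loop_mul_mul_inv hu, h1, ← loop_flexible] at h
  rw [← h, loop_mul_mul_inv (loop_inv_mul hv)]

theorem leftTr_apply [IsLoop Q] (x y : Q) : leftTr x y = x * y := rfl

theorem leftTr_pow [IsMoufangLoop Q] (x : Q) (n : ℕ) :
    leftTr ((leftTr x ^ n) 1) = leftTr x ^ n := by
  induction n using Nat.strong_induction_on with
  | _ n ih =>
    match n with
    | 0 => ext y; exact IsLoop.one_mul' y
    | 1 => rw [pow_one, leftTr_apply, IsLoop.mul_one']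
    | n + 2 =>
      have h0 := ih n (by omega)
      have h2 : (leftTr x ^ n) x = (leftTr x ^ (n + 1)) 1 := by
        rw [pow_succ, Equiv.Perm.mul_apply, leftTr_apply, IsLoop.mul_one']
      have h3 : (leftTr x ^ (n + 2)) 1 = x * ((leftTr x ^ n) 1 * x) := by
        rw [← leftTr_apply ((leftTr x ^ n) 1), h0, h2, pow_succ', Equiv.Perm.mul_apply,
          leftTr_apply]
      ext z
      rw [h3, leftTr_apply, ← leftTr_conj, ← leftTr_apply ((leftTr x ^ n) 1), h0,
        ← leftTr_apply x z, ← leftTr_apply x, pow_succ', pow_succ, Equiv.Perm.mul_apply,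
        Equiv.Perm.mul_apply]

theorem leftTr_lpow [IsMoufangLoop Q] (x : Q) (i : ℤ) : leftTr (lpow x i) = leftTr x ^ i := by
  unfold lpow
  obtain ⟨u, hu⟩ := loop_exists_inv x
  have hi : (leftTr x)⁻¹ = leftTr u := by
    rw [inv_eq_iff_mul_eq_one]
    ext z
    exact loop_mul_inv_mul hu z
  cases i with
  | ofNat n => simpa using leftTr_pow x n
  | negSucc n => rw [zpow_negSucc, ← inv_pow, hi, leftTr_pow]

theorem lpow_mul_lpow [IsMoufangLoop Q] (x : Q) (i j : ℤ) :
    lpow x i * lpow x j = lpow x (i + j) := by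
  rw [← leftTr_apply, leftTr_lpow, lpow, lpow, zpow_add, Equiv.Perm.mul_apply]

theorem exists_lpow [IsMoufangLoop Q] {b x : Q} (hx : x ∈ cyclicSubloop b) :
    ∃ i : ℤ, lpow b i = x := by
  let P : Subloop Q :=
    { carrier := Set.range (lpow b)
      one_mem := ⟨0, by simp [lpow]⟩
      mul_mem := by
        rintro _ _ ⟨i, rfl⟩ ⟨j, rfl⟩
        exact ⟨i + j, (lpow_mul_lpow b i j).symm⟩
      ldiv_mem := by
        rintro _ _ ⟨i, rfl⟩ ⟨j, rfl⟩
        refine ⟨j - i, loop_left_cancel (x := lpow b i) ?_⟩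
        rw [mul_ldiv, lpow_mul_lpow]
        congr 1; ring
      rdiv_mem := by
        rintro _ _ ⟨i, rfl⟩ ⟨j, rfl⟩
        refine ⟨j - i, loop_right_cancel (x := lpow b i) ?_⟩
        rw [lpow_mul_lpow]
        refine Eq.trans ?_ ((rightTr (lpow b i)).apply_symm_apply (lpow b j)).symm
        congr 1; ring }
  exact hx P ⟨1, by rw [lpow, zpow_one, leftTr_apply, IsLoop.mul_one']⟩

/-- In a Moufang loop the subloop `⟨b⟩` is a group under the multiplication of the loop. -/
noncomputable instance [IsMoufangLoop Q] (b : Q) : Group (cyclicSubloop b) where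
  mul x y := ⟨(x : Q) * y, (cyclicSubloop b).mul_mem x.2 y.2⟩
  one := ⟨1, (cyclicSubloop b).one_mem⟩
  inv x := ⟨(leftTr (x : Q)).symm 1, (cyclicSubloop b).ldiv_mem x.2 (cyclicSubloop b).one_mem⟩
  mul_assoc x y z := Subtype.ext (by
    obtain ⟨i, hi⟩ := exists_lpow x.2
    obtain ⟨j, hj⟩ := exists_lpow y.2
    obtain ⟨k, hk⟩ := exists_lpow z.2
    change ((x : Q) * y) * z = x * (y * z)
    rw [← hi, ← hj, ← hk, lpow_mul_lpow, lpow_mul_lpow, lpow_mul_lpow, lpow_mul_lpow, add_assoc])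
  one_mul x := Subtype.ext (IsLoop.one_mul' (x : Q))
  mul_one x := Subtype.ext (IsLoop.mul_one' (x : Q))
  inv_mul_cancel x := Subtype.ext (loop_inv_mul (mul_ldiv (x : Q) 1))

theorem conjMap_mem_iff [IsLoop Q] (X : AbelianSubgroup Q) (hX : X.toSubloop.IsNormal) (a x : Q) :
    conjMap a x ∈ X ↔ x ∈ X := by
  have hT : conjMap a ∈ multGroup Q :=
    mul_mem (inv_mem (Subgroup.subset_closure (Or.inr ⟨a, rfl⟩)))
      (Subgroup.subset_closure (Or.inl ⟨a, rfl⟩))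
  have h1 : conjMap a 1 = 1 := by
    change (rightTr a).symm (a * 1) = 1
    rw [Equiv.symm_apply_eq]
    exact (IsLoop.mul_one' a).trans (IsLoop.one_mul' a).symm
  constructor
  · intro h
    have h2 := hX _ (inv_mem hT) (by rw [Equiv.Perm.inv_eq_iff_eq, h1]) _ h
    have h3 : (conjMap a)⁻¹ (conjMap a x) = x := (conjMap a).symm_apply_apply x
    rwa [h3] at h2
  · exact hX _ hT h1 x

/-- The restriction of `T_a` to a normal abelian subgroup `X`. -/
noncomputable def conjRestrict [IsLoop Q] (X : AbelianSubgroup Q) (hX : X.toSubloop.IsNormal)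
    (a : Q) : Equiv.Perm X :=
  (conjMap a).subtypePerm (conjMap_mem_iff X hX a)

end Subloops

section Pairs

variable {X : Type*} [AddCommGroup X]

/-- Symmetric, alternating, biadditive mappings `X × X → X`. -/
structure IsSymmAltBiadditive (γ : X → X → X) : Prop where
  symm : ∀ x y, γ x y = γ y x
  alt : ∀ x, γ x x = 0
  add_left : ∀ x y z, γ (x + y) z = γ x z + γ y z
  add_right : ∀ x y z, γ x (y + z) = γ x y + γ x z

/-- Construction pairs on an abelian group. -/
structure IsConstructionPair (g : Equiv.Perm X) (γ : X → X → X) : Prop where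
  biadditive : IsSymmAltBiadditive γ
  add_eq : ∀ x y, g⁻¹ (g x + g y) = x + y + γ x y + g⁻¹ (γ x y) + (g ^ (-2 : ℤ)) (γ x y)
  rad : ∀ x y z, γ (γ x y) z = 0
  inv_apply : ∀ x y, g⁻¹ (γ x y) = γ (g x) y

/-- The mapping `β(x, y) = f⁻¹(f(x) + f(y)) - x - y` associated with a permutation `f`. -/
def assocMap (f : Equiv.Perm X) (x y : X) : X := f⁻¹ (f x + f y) - x - y

/-- Moufang permutations on an abelian group. -/
structure IsMoufangPerm (f : Equiv.Perm X) : Prop where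
  biadditive : IsSymmAltBiadditive (assocMap f)
  rad : ∀ x y z, assocMap f (assocMap f x y) z = 0
  apply_apply : ∀ x y, assocMap f (f x) (f y) = f (assocMap f ((f ^ 3) x) y)

/-- The radical of a symmetric mapping. -/
def radicalSet (γ : X → X → X) : Set X := {x | ∀ y, γ x y = 0}

/-- `r(g, γ)`: the least `r > 0` such that `∑_{0 ≤ k < r} g ^ k (x)` is in the radical of `γ` for
every `x`. The value is `0` (in place of `∞`) if there is no such `r`; then, as for `∞`, it divides
no positive integer. -/
noncomputable def rParam (g : Equiv.Perm X) (γ : X → X → X) : ℕ :=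
  sInf {r : ℕ | 0 < r ∧ ∀ x, ∑ k ∈ Finset.range r, (g ^ k) x ∈ radicalSet γ}

/-- The interval `I(i, j)` of integers: `{i, …, j - 1}` if `i < j`, `{j, …, i - 1}` if `j < i`, and
empty if `i = j`. -/
noncomputable def intervalI (i j : ℤ) : Finset ℤ := if i < j then Finset.Ico i j else Finset.Ico j i

/-- The second component of the product of `(b ^ i, x)` and `(b ^ j, y)`. -/
noncomputable def extFormula (g : Equiv.Perm X) (γ : X → X → X) (i j : ℤ) (x y : X) : X :=
  (g ^ (-j)) x + y + ∑ k ∈ intervalI (i + j) (-j), (g ^ (-k)) (γ x y)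

/-- The assumptions under which the product of `C = ⟨b⟩` and `X` is formed. If `g` has infinite
order then `orderOf g = 0` divides no positive integer. -/
structure ExtAssumptions {C : Type*} [Group C] (b : C) (g : Equiv.Perm X) (γ : X → X → X) :
    Prop where
  generates : ∀ c : C, c ∈ Subgroup.zpowers b
  pair : IsConstructionPair g γ
  order_dvd : Finite C → orderOf g ∣ Nat.card C
  r_dvd : Finite C → rParam g γ ∣ Nat.card C

/-- The underlying set `C × X` of the product of `C = ⟨b⟩` and `X` with respect to `(g, γ)`. -/
@[ext]
structure CyclicExt {C X : Type*} [Group C] [AddCommGroup X] (b : C) (g : Equiv.Perm X)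
    (γ : X → X → X) where
  fst : C
  snd : X

open Classical in
/-- Some `i` with `b ^ i = c`, if there is one. -/
noncomputable def genExponent {C : Type*} [Group C] (b c : C) : ℤ :=
  if h : ∃ i : ℤ, b ^ i = c then h.choose else 0

/-- The multiplication on `C × X`, evaluated with chosen exponents. -/
noncomputable instance {C : Type*} [Group C] (b : C) (g : Equiv.Perm X) (γ : X → X → X) :
    Mul (CyclicExt b g γ) where
  mul p q := ⟨p.fst * q.fst, extFormula g γ (genExponent b p.fst) (genExponent b q.fst) p.snd q.snd⟩

instance {C : Type*} [Group C] (b : C) (g : Equiv.Perm X) (γ : X → X → X) :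
    One (CyclicExt b g γ) where
  one := ⟨1, 0⟩

/-- The defining formula of the multiplication does not depend on the choice of exponents: it holds
for all exponents `i` and `j`. -/
def CyclicExt.WellDefined {C : Type*} [Group C] (b : C) (g : Equiv.Perm X) (γ : X → X → X) : Prop :=
  ∀ (i j : ℤ) (x y : X),
    (⟨b ^ i, x⟩ : CyclicExt b g γ) * ⟨b ^ j, y⟩ = ⟨b ^ (i + j), extFormula g γ i j x y⟩

end Pairs

end Moufang

open Moufang

/-! Write `x +_n y` for `f^(-n)(f^n x + f^n y)`, the addition of `X` transported along `f^n`
(`transportAdd`). The Moufang law says that `(L_a, R_a, L_a R_a)` is an autotopism, and together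
with the left Bol identity it makes `T_a⁻¹` a pseudoautomorphism with companion `a^3`. Taking powers
gives `(a^(3i) x) y = a^(3i) (x +_i y)` on `X`, and then the product formula that carries everything
(`leftTr_zpow_mul_leftTr_zpow`): `(a^(3i) x)(a^(3j) y) = a^(3(i+j)) (f^(-3j) x +_(i+2j) y)`.

Substituting this formula into the Moufang law with one factor in `X` yields a family of identities
between the operations `+_n` (`TransportMoufang`). Special exponents force `β(x, y) = (x +_1 y) - x
- y` to be alternating, biadditive and radical-valued, and to interact correctly with `f`; so `f` is
a Moufang permutation.

Conversely, for a Moufang permutation `x +_n y` is `x + y` plus a sum of the elements `f^(-3k) β(x,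
y)` over an interval (`transportAdd_eq_sum`). Hence the multiplication of `M` is the product formula
above (`extFormula_eq`), and `(c, x) ↦ c x` is a homomorphism. The pair formed by the `C`-component
and this image determines an element of `M`, so `M` embeds in `C × Q`; this gives independence of
the exponents and the Moufang law. Admissibility holds because `a^(3m) = 1` for `m = |C|` forces
`f^(3m) = 1` and `+_m = +`. -/

namespace Moufang

/-! ### Transported additions, and Moufang permutations from the transported Moufang law. -/

section Permutations

variable {X : Type*} [AddCommGroup X]

/-- The group operation on `X` transported along `f ^ n`. -/
def transportAdd (f : Equiv.Perm X) (n : ℤ) (x y : X) : X := (f ^ (-n)) ((f ^ n) x + (f ^ n) y)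

theorem zpow_zpow_apply {α : Type*} (f : Equiv.Perm α) (m n : ℤ) (x : α) :
    (f ^ m) ((f ^ n) x) = (f ^ (m + n)) x := by
  rw [zpow_add, Equiv.Perm.mul_apply]

theorem zpow_transportAdd (f : Equiv.Perm X) (k n : ℤ) (x y : X) :
    (f ^ k) (transportAdd f n x y) = transportAdd f (n - k) ((f ^ k) x) ((f ^ k) y) := by
  simp only [transportAdd, zpow_zpow_apply]
  congr 2 <;> ring_nf

theorem transportAdd_zero (f : Equiv.Perm X) (x y : X) : transportAdd f 0 x y = x + y := by
  simp [transportAdd]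

theorem transportAdd_comm (f : Equiv.Perm X) (n : ℤ) (x y : X) :
    transportAdd f n x y = transportAdd f n y x := by
  simp only [transportAdd, add_comm]

theorem transportAdd_assoc (f : Equiv.Perm X) (n : ℤ) (x y z : X) :
    transportAdd f n (transportAdd f n x y) z = transportAdd f n x (transportAdd f n y z) := by
  simp [transportAdd, add_assoc]

theorem exists_transportAdd_eq (f : Equiv.Perm X) (n : ℤ) (x w : X) :
    ∃ y, transportAdd f n x y = w :=
  ⟨(f ^ (-n)) ((f ^ n) w - (f ^ n) x), by simp [transportAdd]⟩

theorem zpow_apply_zero {f : Equiv.Perm X} (h0 : f 0 = 0) (n : ℤ) : (f ^ n) 0 = 0 := by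
  have h : ∀ m : ℕ, (f ^ m) 0 = 0 := fun m => by
    induction m with
    | zero => rfl
    | succ m ih => rw [pow_succ, Equiv.Perm.mul_apply, h0, ih]
  cases n with
  | ofNat m => exact h m
  | negSucc m => rw [zpow_negSucc, Equiv.Perm.inv_eq_iff_eq, h]

theorem transportAdd_right_zero {f : Equiv.Perm X} (h0 : f 0 = 0) (n : ℤ) (x : X) :
    transportAdd f n x 0 = x := by
  simp [transportAdd, zpow_apply_zero h0]

theorem transportAdd_left_zero {f : Equiv.Perm X} (h0 : f 0 = 0) (n : ℤ) (x : X) :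
    transportAdd f n 0 x = x := by
  rw [transportAdd_comm, transportAdd_right_zero h0]

theorem transportAdd_one (f : Equiv.Perm X) (x y : X) :
    transportAdd f 1 x y = x + y + assocMap f x y := by
  simp [transportAdd, assocMap]

/-- The identity on the transported operations that expresses the Moufang law for one factor
in `X`. -/
def TransportMoufang (f : Equiv.Perm X) : Prop :=
  ∀ (j k : ℤ) (x y z : X),
    transportAdd f (j + 2 * k) (transportAdd f (2 * j + 3 * k) ((f ^ (-(3 * (j + k)))) x) y)
        (transportAdd f k z x) =
      transportAdd f (j + k) (transportAdd f (2 * (j + k)) ((f ^ (-(3 * (j + k)))) x)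
        (transportAdd f (j + 2 * k) y z)) x

namespace TransportMoufang

variable {f : Equiv.Perm X}

theorem add_self (h0 : f 0 = 0) (H : TransportMoufang f) (k : ℤ) (x : X) :
    transportAdd f k x x = x + x := by
  have h := H (-k) k x 0 0
  have e1 : 2 * -k + 3 * k = k := by ring
  have e2 : -k + 2 * k = k := by ring
  simpa [e1, e2, transportAdd_right_zero h0, transportAdd_left_zero h0, transportAdd_zero] using h

theorem transport_add (h0 : f 0 = 0) (H : TransportMoufang f) (n : ℤ) (x z : X) :
    transportAdd f n (transportAdd f (2 * n) ((f ^ (-(3 * n))) x) z) x =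
      transportAdd f n ((f ^ (-(3 * n))) x) (z + x) := by
  have h := H n 0 x 0 z
  simp only [mul_zero, add_zero, transportAdd_right_zero h0, transportAdd_left_zero h0,
    transportAdd_zero] at h
  exact h.symm

theorem transport_add_right (h0 : f 0 = 0) (H : TransportMoufang f) (n : ℤ) (x z : X) :
    transportAdd f n ((f ^ (-(3 * n))) x) (z + x) =
      transportAdd f n ((f ^ (-(3 * n))) x) z + x := by
  have h := H 0 n ((f ^ (-n)) x) 0 ((f ^ (-n)) z)
  simp only [mul_zero, zero_add, transportAdd_right_zero h0, transportAdd_left_zero h0] at h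
  have h' := congrArg (f ^ n) h
  simp only [zpow_transportAdd, zpow_zpow_apply] at h'
  have e1 : 2 * n - n = n := by ring
  have e2 : n + (-(3 * n) + -n) = -(3 * n) := by ring
  simpa [e1, e2, transportAdd_zero] using h'

/-- For fixed `x` the translation `w ↦ w + x` is an affine map of the group `(X, +_n)`. Biadditivity
of `β` and the radical property are both read off from this. -/
theorem add_affine (h0 : f 0 = 0) (H : TransportMoufang f) (n : ℤ) (w x z : X) :
    transportAdd f n (w + x) (z + x) = transportAdd f n (transportAdd f n w z + x) x := by
  -- Writing `w = f^(-3n) x +_n y` gives the shape required by the case `k = 0` of the Moufang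
  -- identity.
  obtain ⟨y, rfl⟩ := exists_transportAdd_eq f n ((f ^ (-(3 * n))) x) w
  have h1 := H n 0 x y z
  simp only [mul_zero, add_zero, transportAdd_zero] at h1
  rw [transport_add h0 H, transport_add_right h0 H] at h1
  rw [← transport_add_right h0 H, ← transport_add h0 H, transportAdd_assoc,
    transportAdd_comm f n x, ← transportAdd_assoc, h1, transportAdd_assoc f n _ y z]

theorem assocMap_comm (f : Equiv.Perm X) (x y : X) : assocMap f x y = assocMap f y x := by
  simp only [assocMap, add_comm (f x), sub_right_comm]

theorem assocMap_self (h0 : f 0 = 0) (H : TransportMoufang f) (x : X) : assocMap f x x = 0 := by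
  have h := add_self h0 H 1 x
  rwa [transportAdd_one, add_eq_left] at h

theorem assocMap_add_left (h0 : f 0 = 0) (H : TransportMoufang f) (w z x : X) :
    assocMap f (w + z) x = assocMap f w x + assocMap f z x := by
  -- Applying `f⁻¹` turns `+_(-1)` into `+` and `+` into `+_1`, so the affine property becomes `(w
  -- +_1 x) + (z +_1 x) = ((w + z) +_1 x) + x`.
  have h := congrArg (f ^ (-1 : ℤ)) (add_affine h0 H (-1) (f w) (f x) (f z))
  have e : ∀ u, (f ^ (-1 : ℤ)) (f u) = u := fun u => by simp
  have e2 : ∀ u v : X, (f ^ (-1 : ℤ)) (u + v) =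
      transportAdd f 1 ((f ^ (-1 : ℤ)) u) ((f ^ (-1 : ℤ)) v) := fun u v => by
    simp [transportAdd]
  rw [zpow_transportAdd, zpow_transportAdd, e2, e2, e2, zpow_transportAdd] at h
  simp only [sub_self, transportAdd_zero, transportAdd_one, e] at h
  have h2 : assocMap f w x + assocMap f z x - assocMap f (w + z) x = 0 := by
    rw [← sub_eq_zero] at h
    rw [← h]; abel
  exact (sub_eq_zero.mp h2).symm

theorem assocMap_biadditive (h0 : f 0 = 0) (H : TransportMoufang f) :
    IsSymmAltBiadditive (assocMap f) where
  symm := assocMap_comm f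
  alt := assocMap_self h0 H
  add_left := assocMap_add_left h0 H
  add_right x y z := by
    rw [assocMap_comm f x, assocMap_add_left h0 H, assocMap_comm f x y, assocMap_comm f x z]

end TransportMoufang

namespace IsSymmAltBiadditive

variable {γ : X → X → X}

theorem zero_left (h : IsSymmAltBiadditive γ) (y : X) : γ 0 y = 0 := by
  have := h.add_left 0 0 y
  rwa [add_zero, left_eq_add] at this

theorem neg_left (h : IsSymmAltBiadditive γ) (x y : X) : γ (-x) y = -γ x y := by
  rw [eq_neg_iff_add_eq_zero, ← h.add_left, neg_add_cancel, h.zero_left]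

theorem add_self_eq_zero (h : IsSymmAltBiadditive γ) (x y : X) : γ x y + γ x y = 0 := by
  have := h.alt (x + y)
  rwa [h.add_left, h.add_right, h.add_right, h.alt, h.alt, zero_add, add_zero, h.symm y x] at this

theorem neg_eq_self (h : IsSymmAltBiadditive γ) (x y : X) : -γ x y = γ x y :=
  neg_eq_of_add_eq_zero_left (h.add_self_eq_zero x y)

end IsSymmAltBiadditive

namespace TransportMoufang

variable {f : Equiv.Perm X}

/-- Expanding the affine property for `+_1` by biadditivity, every term cancels except this one. -/
theorem assocMap_assocMap (h0 : f 0 = 0) (H : TransportMoufang f) (w z x : X) :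
    assocMap f (assocMap f w z) x = 0 := by
  have hB := assocMap_biadditive h0 H
  have h := add_affine h0 H 1 w x z
  simp only [transportAdd_one, hB.add_left, hB.add_right, hB.alt, hB.symm x z] at h
  rw [← sub_eq_zero] at h
  rw [← neg_eq_zero, ← h]
  abel

/-- The left side is `z +_(-1) x`; the exponents `j = 2`, `k = -1` are those that compare `+_(-1)`
with `+_1`. -/
theorem apply_inv_add_inv (h0 : f 0 = 0) (H : TransportMoufang f) (x z : X) :
    f (f⁻¹ z + f⁻¹ x) = z + x + assocMap f ((f ^ (-3 : ℤ)) x) z := by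
  have h := H 2 (-1) x 0 z
  have h1 := transport_add h0 H 1 x z
  have h2 := transport_add_right h0 H 1 x z
  have e1 : (2 : ℤ) + 2 * -1 = 0 := by norm_num
  have e2 : (2 : ℤ) + -1 = 1 := by norm_num
  have e3 : -(3 * 1 : ℤ) = -3 := by norm_num
  rw [e1, e2, transportAdd_right_zero h0, transportAdd_left_zero h0, transportAdd_zero, h1, h2,
    e3, transportAdd_one] at h
  have h3 : transportAdd f (-1) z x = f (f⁻¹ z + f⁻¹ x) := by simp [transportAdd]
  rw [h3] at h
  rw [eq_sub_of_add_eq' h]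
  abel

theorem apply_assocMap (h0 : f 0 = 0) (H : TransportMoufang f) (u v : X) :
    f (assocMap f u v) = assocMap f ((f ^ (-2 : ℤ)) u) (f v) := by
  have hB := assocMap_biadditive h0 H
  have hr := assocMap_assocMap h0 H
  have hadd : ∀ p q : X, f (p + q) = f p + f q + assocMap f ((f ^ (-2 : ℤ)) p) (f q) := by
    intro p q
    have h := apply_inv_add_inv h0 H (f p) (f q)
    have e : (f ^ (-3 : ℤ)) (f p) = (f ^ (-2 : ℤ)) p := by
      have := zpow_zpow_apply f (-3) 1 p
      rwa [zpow_one] at this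
    have e0 : ∀ u, f⁻¹ (f u) = u := f.symm_apply_apply
    rw [e0, e0, e, add_comm q, add_comm (f q)] at h
    exact h
  have h1 : f (u + v + assocMap f u v) = f u + f v := by
    rw [← transportAdd_one]; simp [transportAdd]
  rw [hadd, hadd u v] at h1
  set e := assocMap f ((f ^ (-2 : ℤ)) u) (f v) with he
  set t := assocMap f ((f ^ (-2 : ℤ)) (u + v)) (f (assocMap f u v)) with ht
  have h2 : f (assocMap f u v) = -e + -t := by
    rw [← sub_eq_zero] at h1 ⊢
    rw [← h1]; abel
  -- `t` is `β` evaluated at `f (β(u, v)) = -e - t`. Since `e` and `t` are themselves values of `β`,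
  -- they lie in the radical, and so `t` vanishes.
  have h3 : t = 0 := by
    rw [ht, h2, hB.symm, hB.add_left, hB.neg_left, hB.neg_left, he, hr, ht, hr]; simp
  rw [h2, h3, neg_zero, add_zero, he, hB.neg_eq_self]

theorem isMoufangPerm (h0 : f 0 = 0) (H : TransportMoufang f) : IsMoufangPerm f where
  biadditive := assocMap_biadditive h0 H
  rad := assocMap_assocMap h0 H
  apply_apply x y := by
    rw [apply_assocMap h0 H, ← zpow_natCast, zpow_zpow_apply]
    norm_num

end TransportMoufang

end Permutations

end Moufang

/-! ### Moufang permutations: interval sums and construction pairs. -/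

namespace Moufang

theorem map_zpow_apply {α α' : Type*} {e : Equiv.Perm α} {e' : Equiv.Perm α'} {φ : α → α'}
    (h : ∀ x, φ (e x) = e' (φ x)) (n : ℤ) (x : α) : φ ((e ^ n) x) = (e' ^ n) (φ x) := by
  have hpow : ∀ (m : ℕ) (x : α), φ ((e ^ m) x) = (e' ^ m) (φ x) := fun m => by
    induction m with
    | zero => intro x; rfl
    | succ m ih =>
      intro x
      rw [pow_succ', pow_succ', Equiv.Perm.mul_apply, Equiv.Perm.mul_apply, h, ih]
  cases n with
  | ofNat m => exact hpow m x
  | negSucc m =>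
    rw [zpow_negSucc, zpow_negSucc, Equiv.Perm.eq_inv_iff_eq, ← hpow]
    exact congrArg φ ((e ^ (m + 1)).apply_symm_apply x)

theorem map_zpow_apply₂ {α₁ α₂ α' : Type*} {e₁ : Equiv.Perm α₁} {e₂ : Equiv.Perm α₂}
    {e' : Equiv.Perm α'} {φ : α₁ → α₂ → α'} (h : ∀ x y, φ (e₁ x) (e₂ y) = e' (φ x y)) (n : ℤ)
    (x : α₁) (y : α₂) : φ ((e₁ ^ n) x) ((e₂ ^ n) y) = (e' ^ n) (φ x y) := by
  have h1 := map_zpow_apply (e := e₁.prodCongr e₂) (φ := fun p => φ p.1 p.2)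
    (fun p => h p.1 p.2) n (x, y)
  have hfst := map_zpow_apply (e := e₁.prodCongr e₂) (e' := e₁) (φ := Prod.fst)
    (fun _ => rfl) n (x, y)
  have hsnd := map_zpow_apply (e := e₁.prodCongr e₂) (e' := e₂) (φ := Prod.snd)
    (fun _ => rfl) n (x, y)
  simpa only [hfst, hsnd] using h1

section Intervals

variable {X : Type*} [AddCommGroup X]

theorem sum_intervalI_shift (h : ℤ → X) (i j c : ℤ) :
    ∑ k ∈ intervalI (i + c) (j + c), h k = ∑ k ∈ intervalI i j, h (k + c) := by
  have e : intervalI (i + c) (j + c) = (intervalI i j).map (addRightEmbedding c) := by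
    unfold intervalI
    by_cases hij : i < j
    · rw [if_pos hij, if_pos (by omega), Finset.map_add_right_Ico]
    · rw [if_neg hij, if_neg (by omega), Finset.map_add_right_Ico]
  rw [e, Finset.sum_map]
  rfl

/-- When all terms have exponent two, adding and removing the index `i` have the same effect, so
both orientations of the interval obey one recurrence. -/
theorem sum_intervalI_add_one (h : ℤ → X) (h2 : ∀ k, h k + h k = 0) (i j : ℤ) :
    ∑ k ∈ intervalI (i + 1) j, h k = ∑ k ∈ intervalI i j, h k + h i := by
  unfold intervalI
  by_cases hij : i < j
  · have e : Finset.Ico i j = insert i (Finset.Ico (i + 1) j) := by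
      ext k; simp only [Finset.mem_Ico, Finset.mem_insert]; omega
    have e2 : (if i + 1 < j then Finset.Ico (i + 1) j else Finset.Ico j (i + 1)) =
        Finset.Ico (i + 1) j := by
      by_cases hij' : i + 1 < j
      · rw [if_pos hij']
      · rw [if_neg hij', Finset.Ico_eq_empty (by omega), Finset.Ico_eq_empty (by omega)]
    rw [if_pos hij, e2, e, Finset.sum_insert (by simp), add_right_comm, h2, zero_add]
  · have e : Finset.Ico j (i + 1) = insert i (Finset.Ico j i) := by
      ext k; simp only [Finset.mem_Ico, Finset.mem_insert]; omega
    rw [if_neg hij, if_neg (by omega), e, Finset.sum_insert (by simp), add_comm]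

end Intervals

namespace IsMoufangPerm

variable {X : Type*} [AddCommGroup X] {f : Equiv.Perm X}

theorem map_zero (hf : IsMoufangPerm f) : f 0 = 0 := by
  have h := hf.biadditive.alt 0
  rw [assocMap, sub_zero, sub_zero, Equiv.Perm.inv_eq_iff_eq] at h
  rwa [add_eq_left] at h

theorem apply_assocMap_left (hf : IsMoufangPerm f) (u v : X) :
    f (assocMap f u v) = assocMap f ((f ^ (-2 : ℤ)) u) (f v) := by
  have h := hf.apply_apply ((f ^ (-3 : ℤ)) u) v
  rw [← zpow_natCast, zpow_zpow_apply] at h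
  have h1 := zpow_zpow_apply f 1 (-3) u
  rw [zpow_one] at h1
  rw [h1] at h
  norm_num at h ⊢
  exact h.symm

theorem apply_assocMap_right (hf : IsMoufangPerm f) (u v : X) :
    f (assocMap f u v) = assocMap f (f u) ((f ^ (-2 : ℤ)) v) := by
  rw [hf.biadditive.symm, hf.apply_assocMap_left, hf.biadditive.symm]

theorem cube_assocMap (hf : IsMoufangPerm f) (u v : X) :
    (f ^ 3) (assocMap f u v) = assocMap f ((f ^ 3)⁻¹ u) v := by
  have e : ∀ w, (f ^ 3) w = f (f (f w)) := fun w => rfl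
  have e1 : f ((f ^ (-2 : ℤ)) ((f ^ (-2 : ℤ)) u)) = (f ^ 3)⁻¹ u := by
    have h := zpow_zpow_apply f 1 (-2 + -2) u
    rw [zpow_one, ← zpow_zpow_apply] at h
    rw [h]; rfl
  have e2 : (f ^ (-2 : ℤ)) (f (f v)) = v := (f ^ 2).symm_apply_apply v
  -- Each `f` acts as `f` on one argument and as `f^(-2)` on the other; using left, left, right
  -- leaves `f^(-3)` on `u` and the identity on `v`.
  rw [e, hf.apply_assocMap_left, hf.apply_assocMap_left, hf.apply_assocMap_right, e1, e2]

theorem cube_zpow_assocMap (hf : IsMoufangPerm f) (n : ℤ) (u v : X) :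
    ((f ^ 3) ^ (-n)) (assocMap f u v) = assocMap f (((f ^ 3) ^ n) u) v := by
  have h := map_zpow_apply (e := (f ^ 3)⁻¹) (e' := f ^ 3) (φ := fun x => assocMap f x v)
    (fun x => (hf.cube_assocMap x v).symm) (-n) u
  rw [inv_zpow', neg_neg] at h
  exact h.symm

theorem assocMap_zpow (hf : IsMoufangPerm f) (n : ℤ) (x y : X) :
    assocMap f ((f ^ n) x) ((f ^ n) y) = (f ^ (-2 * n)) (assocMap f x y) := by
  have h := map_zpow_apply₂ (e₁ := f) (e₂ := f) (e' := f ^ (-2 : ℤ)) (φ := assocMap f) (fun x y => by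
    have h := hf.cube_zpow_assocMap 1 x y
    rw [zpow_one] at h
    rw [hf.apply_apply, ← h]
    have h1 := zpow_zpow_apply f 1 (-3) (assocMap f x y)
    rw [zpow_one] at h1
    exact h1) n x y
  rwa [← zpow_mul] at h

theorem zpow_mem_radicalSet (hf : IsMoufangPerm f) (n : ℤ) {q : X}
    (hq : q ∈ radicalSet (assocMap f)) : (f ^ n) q ∈ radicalSet (assocMap f) := by
  intro y
  have h := hf.assocMap_zpow n q ((f ^ (-n)) y)
  rwa [hq, zpow_zpow_apply, add_neg_cancel, zpow_zero, Equiv.Perm.one_apply,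
    zpow_apply_zero hf.map_zero] at h

theorem apply_add_of_mem_radicalSet (hf : IsMoufangPerm f) (p : X) {q : X}
    (hq : q ∈ radicalSet (assocMap f)) : f (p + q) = f p + f q := by
  have h : assocMap f p q = 0 := by rw [hf.biadditive.symm]; exact hq p
  rw [assocMap, sub_sub, sub_eq_zero, Equiv.Perm.inv_eq_iff_eq] at h
  exact h.symm

theorem zpow_add_of_mem_radicalSet (hf : IsMoufangPerm f) (n : ℤ) (p : X) {q : X}
    (hq : q ∈ radicalSet (assocMap f)) : (f ^ n) (p + q) = (f ^ n) p + (f ^ n) q := by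
  induction n using Int.induction_on with
  | zero => rfl
  | succ n ih =>
    simp only [add_comm (n : ℤ) 1, zpow_one_add, Equiv.Perm.mul_apply]
    rw [ih, hf.apply_add_of_mem_radicalSet _ (hf.zpow_mem_radicalSet _ hq)]
  | pred n ih =>
    apply f.injective
    rw [hf.apply_add_of_mem_radicalSet _ (hf.zpow_mem_radicalSet _ hq)]
    have e : ∀ u, f ((f ^ (-(n : ℤ) - 1)) u) = (f ^ (-(n : ℤ))) u := fun u => by
      have := zpow_zpow_apply f 1 (-(n : ℤ) - 1) u
      rwa [zpow_one, add_sub_cancel] at this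
    rw [e, e, e, ih]

theorem assocMap_mem_radicalSet (hf : IsMoufangPerm f) (x y : X) :
    assocMap f x y ∈ radicalSet (assocMap f) := fun z => hf.rad x y z

/-- The correction `β(f^n x, f^n y) = f^(-2n) β(x, y)` lies in the radical, so `f^(-n)` splits it
off additively, and it becomes `f^(-3n) β(x, y)`. -/
theorem transportAdd_add_one (hf : IsMoufangPerm f) (n : ℤ) (x y : X) :
    transportAdd f (n + 1) x y = transportAdd f n x y + ((f ^ 3) ^ (-n)) (assocMap f x y) := by
  have h1 : transportAdd f (n + 1) x y = (f ^ (-n)) (transportAdd f 1 ((f ^ n) x) ((f ^ n) y)) := by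
    rw [zpow_transportAdd, zpow_zpow_apply, zpow_zpow_apply]
    simp [add_comm]
  rw [h1, transportAdd_one, hf.zpow_add_of_mem_radicalSet _ _ (hf.assocMap_mem_radicalSet _ _),
    hf.assocMap_zpow, zpow_zpow_apply, ← zpow_natCast, ← zpow_mul, transportAdd]
  congr 3
  push_cast; ring

theorem transportAdd_eq_sum (hf : IsMoufangPerm f) (n : ℤ) (x y : X) :
    transportAdd f n x y =
      x + y + ∑ k ∈ intervalI n 0, ((f ^ 3) ^ (-k)) (assocMap f x y) := by
  have h2 : ∀ n : ℤ, ∑ k ∈ intervalI (n + 1) 0, ((f ^ 3) ^ (-k)) (assocMap f x y) =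
      ∑ k ∈ intervalI n 0, ((f ^ 3) ^ (-k)) (assocMap f x y) +
        ((f ^ 3) ^ (-n)) (assocMap f x y) := fun n =>
    sum_intervalI_add_one (fun k => ((f ^ 3) ^ (-k)) (assocMap f x y)) (fun k => by
      rw [hf.cube_zpow_assocMap, hf.biadditive.add_self_eq_zero]) n 0
  induction n using Int.induction_on with
  | zero => simp [transportAdd_zero, intervalI]
  | succ n ih => rw [hf.transportAdd_add_one, h2, ih, add_assoc]
  | pred n ih =>
    have h3 := hf.transportAdd_add_one (-(n : ℤ) - 1) x y
    have h4 := h2 (-(n : ℤ) - 1)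
    rw [sub_add_cancel] at h3 h4
    rw [ih, h4, ← add_assoc] at h3
    exact (add_right_cancel h3).symm

theorem isConstructionPair (hf : IsMoufangPerm f) :
    IsConstructionPair (f ^ 3) (assocMap f) where
  biadditive := hf.biadditive
  rad := hf.rad
  inv_apply x y := by
    have h := hf.cube_zpow_assocMap 1 x y
    rwa [zpow_neg, zpow_one] at h
  add_eq x y := by
    -- The required identity is the expansion of `x +_3 y`, obtained by three steps of the
    -- recurrence.
    have h0 := hf.transportAdd_add_one 0 x y
    have h1 := hf.transportAdd_add_one 1 x y
    have h2 := hf.transportAdd_add_one 2 x y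
    norm_num [transportAdd_zero] at h0 h1 h2
    rw [h1, h0] at h2
    exact h2

/-- Shifting `I(i+j, -j)` by `j` gives `I(i+2j, 0)`; the shift is absorbed by `β(f^(-3j) x, y) =
f^(3j) β(x, y)`. -/
theorem extFormula_eq (hf : IsMoufangPerm f) (i j : ℤ) (x y : X) :
    extFormula (f ^ 3) (assocMap f) i j x y =
      transportAdd f (i + 2 * j) (((f ^ 3) ^ (-j)) x) y := by
  have e : intervalI (i + 2 * j) 0 = intervalI (i + j + j) (-j + j) := by
    congr 1 <;> ring
  rw [hf.transportAdd_eq_sum, extFormula, e,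
    sum_intervalI_shift (fun k => ((f ^ 3) ^ (-k)) (assocMap f (((f ^ 3) ^ (-j)) x) y))]
  congr 1
  refine Finset.sum_congr rfl fun k _ => ?_
  rw [← hf.cube_zpow_assocMap, zpow_zpow_apply]
  congr 2; ring

theorem transportAdd_natCast (hf : IsMoufangPerm f) (n : ℕ) (x y : X) :
    transportAdd f n x y =
      x + y + assocMap f (∑ k ∈ Finset.range n, ((f ^ 3) ^ k) x) y := by
  induction n with
  | zero => simp [transportAdd_zero, hf.biadditive.zero_left]
  | succ n ih =>
    rw [Nat.cast_succ, hf.transportAdd_add_one, ih, Finset.sum_range_succ, hf.biadditive.add_left,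
      hf.cube_zpow_assocMap, add_assoc, zpow_natCast]

end IsMoufangPerm

/-- The exponents whose partial sums are always radical are closed under subtraction, since the sum
of length `r + d` at `x` is the one of length `r` at `x` plus the one of length `d` at `g^r x`, and
`g^r` is onto. -/
theorem rParam_dvd {X : Type*} [AddCommGroup X] {g : Equiv.Perm X} {γ : X → X → X}
    (hγ : IsSymmAltBiadditive γ) {m : ℕ} (hm : 0 < m)
    (h : ∀ x, ∑ k ∈ Finset.range m, (g ^ k) x ∈ radicalSet γ) : rParam g γ ∣ m := by
  have hr : rParam g γ ∈ {r : ℕ | 0 < r ∧ ∀ x, ∑ k ∈ Finset.range r, (g ^ k) x ∈ radicalSet γ} :=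
    Nat.sInf_mem ⟨m, hm, h⟩
  have hsub : ∀ n : ℕ, (∀ x, ∑ k ∈ Finset.range n, (g ^ k) x ∈ radicalSet γ) → rParam g γ ∣ n := by
    intro n
    induction n using Nat.strong_induction_on with
    | _ n ih =>
      intro hn
      rcases Nat.eq_zero_or_pos n with rfl | hpos
      · exact dvd_zero _
      have hle : rParam g γ ≤ n := Nat.sInf_le ⟨hpos, hn⟩
      obtain ⟨d, rfl⟩ := Nat.exists_eq_add_of_le hle
      refine dvd_add dvd_rfl (ih d (by have := hr.1; omega) fun x y => ?_)
      have h1 := hn ((g ^ rParam g γ)⁻¹ x) y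
      rw [Finset.sum_range_add, hγ.add_left, hr.2 _ y, zero_add] at h1
      rw [← h1]
      refine congrArg (γ · y) (Finset.sum_congr rfl fun k _ => ?_)
      rw [add_comm, pow_add, Equiv.Perm.mul_apply]
      exact congrArg (g ^ k) ((g ^ rParam g γ).apply_symm_apply x).symm
  exact hsub m h

end Moufang

/-! ### Autotopisms of Moufang loops and the product formula. -/

namespace Moufang

section MoufangLoops

variable {Q : Type*} [Mul Q] [One Q] [IsMoufangLoop Q]

theorem rightTr_apply (x y : Q) : rightTr x y = y * x := rfl

theorem commute_leftTr_rightTr (a : Q) : Commute (leftTr a) (rightTr a) := by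
  ext z
  exact loop_flexible a z

theorem leftTr_mul_rightTr (a x y : Q) :
    leftTr a x * rightTr a y = (leftTr a * rightTr a) (x * y) :=
  (IsMoufangLoop.moufang a x y).trans (loop_flexible a (x * y)).symm

theorem leftTr_mul_rightTr_zpow (a : Q) (n : ℤ) (x y : Q) :
    (leftTr a ^ n) x * (rightTr a ^ n) y = (leftTr a ^ n * rightTr a ^ n) (x * y) := by
  rw [← (commute_leftTr_rightTr a).mul_zpow]
  exact map_zpow_apply₂ (φ := fun x y : Q => x * y) (leftTr_mul_rightTr a) n x y

theorem leftTr_rightTr_mul_inv_leftTr (a x y : Q) :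
    (leftTr a * rightTr a) x * (leftTr a)⁻¹ y = leftTr a (x * y) := by
  have h := leftTr_conj a x ((leftTr a)⁻¹ y)
  have e : a * (leftTr a)⁻¹ y = y := mul_ldiv a y
  rw [e] at h
  exact h.symm

/-- The inverse of the conjugation by `a` is a pseudoautomorphism with companion `a ^ 3`. -/
theorem conj_pseudoautomorphism (a x y : Q) :
    (leftTr a * (leftTr a * rightTr a)) x * (rightTr a * (leftTr a)⁻¹) y =
      (leftTr a * (leftTr a * rightTr a)) (x * y) := by
  have h := leftTr_mul_rightTr a ((leftTr a * rightTr a) x) ((leftTr a)⁻¹ y)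
  rw [leftTr_rightTr_mul_inv_leftTr] at h
  refine h.trans ?_
  rw [← Equiv.Perm.mul_apply, mul_assoc, (commute_leftTr_rightTr a).eq]

theorem conjMap_zpow (a : Q) (n : ℤ) : conjMap a ^ n = (rightTr a ^ n)⁻¹ * leftTr a ^ n := by
  rw [conjMap, (commute_leftTr_rightTr a).symm.inv_left.mul_zpow, inv_zpow]

theorem conjMap_zpow_one (a : Q) (n : ℤ) : (conjMap a ^ n) 1 = 1 := by
  apply Equiv.Perm.zpow_apply_eq_self_of_apply_eq_self
  rw [conjMap, Equiv.Perm.mul_apply, Equiv.Perm.inv_eq_iff_eq, leftTr_apply, rightTr_apply,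
    IsLoop.mul_one', IsLoop.one_mul']

theorem rightTr_zpow_apply (a : Q) (n : ℤ) (w : Q) : (rightTr a ^ n) w = w * lpow a n := by
  have h1 : (rightTr a ^ n) 1 = lpow a n := by
    have h := conjMap_zpow_one a n
    rw [conjMap_zpow, Equiv.Perm.mul_apply, Equiv.Perm.inv_eq_iff_eq] at h
    exact h.symm
  have h := leftTr_mul_rightTr_zpow a n ((leftTr a ^ n)⁻¹ w) 1
  rw [IsLoop.mul_one', h1, ((commute_leftTr_rightTr a).zpow_zpow n n).eq, Equiv.Perm.mul_apply] at h
  have e : (leftTr a ^ n) ((leftTr a ^ n)⁻¹ w) = w := (leftTr a ^ n).apply_symm_apply w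
  rw [e] at h
  exact h.symm

theorem leftTr_zpow_mul (a : Q) (i : ℤ) (x y : Q) :
    (leftTr a ^ (3 * i)) x * y =
      (leftTr a ^ (3 * i)) ((conjMap a ^ (-i)) ((conjMap a ^ i) x * (conjMap a ^ i) y)) := by
  have hc := commute_leftTr_rightTr a
  have h := map_zpow_apply₂ (φ := fun x y : Q => x * y) (conj_pseudoautomorphism a) i
    ((conjMap a ^ i) x) ((conjMap a ^ i) y)
  -- The components of the pseudoautomorphism are `L_a^3 T_a⁻¹` and `T_a⁻¹`; its `i`-th power is
  -- evaluated at `T_a^i x` and `T_a^i y`.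
  have e1 : (leftTr a * (leftTr a * rightTr a)) ^ i = leftTr a ^ (3 * i) * conjMap a ^ (-i) := by
    rw [((Commute.refl _).mul_right hc).mul_zpow, hc.mul_zpow, zpow_neg, conjMap_zpow, mul_inv_rev,
      inv_inv, show 3 * i = i + i + i by ring, zpow_add, zpow_add]
    group
  have e2 : (rightTr a * (leftTr a)⁻¹) ^ i = conjMap a ^ (-i) := by
    rw [zpow_neg, ← inv_zpow, conjMap, mul_inv_rev, inv_inv, hc.inv_left.eq]
  rw [e1, e2, ← Equiv.Perm.mul_apply, ← Equiv.Perm.mul_apply, mul_assoc, ← zpow_add,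
    neg_add_cancel, zpow_zero, mul_one, Equiv.Perm.one_apply] at h
  exact h

variable (X : AbelianSubgroup Q) (hX : X.toSubloop.IsNormal) (a : Q)

theorem coe_conjRestrict_zpow (n : ℤ) (x : X) :
    (((conjRestrict X hX a) ^ n) x : Q) = (conjMap a ^ n) x :=
  map_zpow_apply (φ := ((↑) : X → Q)) (fun _ => rfl) n x

theorem leftTr_zpow_mul_coe (i : ℤ) (x y : X) :
    (leftTr a ^ (3 * i)) x * y =
      (leftTr a ^ (3 * i)) (transportAdd (conjRestrict X hX a) i x y : X) := by
  rw [leftTr_zpow_mul, transportAdd, coe_conjRestrict_zpow, ← coe_conjRestrict_zpow X hX a i x,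
    ← coe_conjRestrict_zpow X hX a i y]
  rfl

theorem leftTr_zpow_mul_leftTr_zpow (i j : ℤ) (x y : X) :
    (leftTr a ^ (3 * i)) x * (leftTr a ^ (3 * j)) y =
      (leftTr a ^ (3 * (i + j))) (transportAdd (conjRestrict X hX a) (i + 2 * j)
        ((conjRestrict X hX a ^ (-(3 * j))) x) y : X) := by
  have hc := commute_leftTr_rightTr a
  -- Since `L_a^(3j) y = R_a^(3j) (f^(3j) y)`, the product is the autotopism `(L_a, R_a, L_a
  -- R_a)^(3j)` applied to `a^(3(i-j)) x` and `f^(3j) y`.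
  have h := leftTr_mul_rightTr_zpow a (3 * j) ((leftTr a ^ (3 * (i - j))) x)
    (((conjRestrict X hX a) ^ (3 * j)) y : X)
  rw [leftTr_zpow_mul_coe X hX, zpow_zpow_apply, coe_conjRestrict_zpow, conjMap_zpow,
    ← Equiv.Perm.mul_apply (rightTr a ^ (3 * j)), mul_inv_cancel_left] at h
  have e1 : 3 * j + 3 * (i - j) = 3 * i := by ring
  rw [e1] at h
  have e2 : transportAdd (conjRestrict X hX a) (i + 2 * j)
        ((conjRestrict X hX a ^ (-(3 * j))) x) y = (conjRestrict X hX a ^ (-(3 * j)))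
        (transportAdd (conjRestrict X hX a) (i - j) x ((conjRestrict X hX a ^ (3 * j)) y)) := by
    rw [zpow_transportAdd, zpow_zpow_apply, neg_add_cancel, zpow_zero, Equiv.Perm.one_apply]
    congr 1; ring
  rw [h, e2, coe_conjRestrict_zpow, ← Equiv.Perm.mul_apply, ← Equiv.Perm.mul_apply, zpow_neg,
    conjMap_zpow, mul_inv_rev, inv_inv]
  congr 1
  rw [mul_assoc, ((hc.zpow_zpow (3 * (i - j)) (3 * j)).symm).eq, ← mul_assoc, ← zpow_add, e1,
    ← mul_assoc, ← zpow_neg, ← zpow_add]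
  congr 2; ring

theorem transportMoufang_conjRestrict : TransportMoufang (conjRestrict X hX a) := by
  intro j k x y z
  set f := conjRestrict X hX a with hf
  -- The factor `f^(3k) y` is chosen so that the `f^(-3k)` produced by the second product cancels.
  have h := IsMoufangLoop.moufang ((leftTr a ^ (3 * (0 : ℤ))) (x : Q))
    ((leftTr a ^ (3 * j)) ((f ^ (3 * k)) y : X)) ((leftTr a ^ (3 * k)) (z : Q))
  simp only [leftTr_zpow_mul_leftTr_zpow X hX, ← hf] at h
  have e : 0 + (j + k) + 0 = 0 + j + (k + 0) := by ring
  rw [e] at h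
  have h1 := Subtype.ext ((leftTr a ^ (3 * (0 + j + (k + 0)))).injective h)
  rw [zpow_transportAdd f (-(3 * (k + 0)))] at h1
  simp only [zero_add, add_zero, mul_zero, neg_zero, zpow_zero, Equiv.Perm.one_apply,
    zpow_zpow_apply, neg_add_cancel] at h1
  have e1 : -(3 * k) + -(3 * j) = -(3 * (j + k)) := by ring
  have e2 : 2 * j - -(3 * k) = 2 * j + 3 * k := by ring
  rwa [e1, e2] at h1

theorem isMoufangPerm_conjRestrict : IsMoufangPerm (conjRestrict X hX a) := by
  refine (transportMoufang_conjRestrict X hX a).isMoufangPerm ?_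
  apply Subtype.ext
  have h := conjMap_zpow_one a 1
  rwa [zpow_one] at h

/-- Left translations by elements of `⟨b⟩`. -/
noncomputable def cyclicLeftTr (b : Q) : cyclicSubloop b →* Equiv.Perm Q :=
  MonoidHom.mk' (fun c => leftTr (c : Q)) (fun c d => by
    obtain ⟨i, hi⟩ := exists_lpow c.2
    obtain ⟨j, hj⟩ := exists_lpow d.2
    change leftTr ((c : Q) * d) = _
    rw [← hi, ← hj, lpow_mul_lpow, leftTr_lpow, leftTr_lpow, leftTr_lpow, zpow_add])

theorem leftTr_cyclicGen_zpow (i : ℤ) :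
    leftTr ((cyclicGen (lpow a 3) ^ i : cyclicSubloop (lpow a 3)) : Q) = leftTr a ^ (3 * i) := by
  have h := map_zpow (cyclicLeftTr (lpow a 3)) (cyclicGen (lpow a 3)) i
  refine h.trans ?_
  change leftTr (lpow a 3) ^ i = _
  rw [leftTr_lpow, zpow_mul]

theorem cyclicGen_zpow_mul (i : ℤ) (x : Q) :
    ((cyclicGen (lpow a 3) ^ i : cyclicSubloop (lpow a 3)) : Q) * x = (leftTr a ^ (3 * i)) x := by
  rw [← leftTr_apply, leftTr_cyclicGen_zpow]

theorem exists_cyclicGen_zpow (b : Q) (c : cyclicSubloop b) : ∃ i : ℤ, cyclicGen b ^ i = c := by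
  obtain ⟨i, hi⟩ := exists_lpow c.2
  refine ⟨i, Subtype.ext ?_⟩
  have h := DFunLike.congr_fun (map_zpow (cyclicLeftTr b) (cyclicGen b) i) 1
  change _ * 1 = (leftTr b ^ i) 1 at h
  rw [IsLoop.mul_one'] at h
  exact h.trans hi

theorem genExponent_spec (b : Q) (c : cyclicSubloop b) :
    cyclicGen b ^ genExponent (cyclicGen b) c = c := by
  rw [genExponent, dif_pos (exists_cyclicGen_zpow b c)]
  exact (exists_cyclicGen_zpow b c).choose_spec

theorem conjRestrict_cube_zpow_eq_one {n : ℤ} (hn : leftTr a ^ (3 * n) = 1) :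
    (conjRestrict X hX a ^ 3) ^ n = 1 := by
  have hR : rightTr a ^ (3 * n) = 1 := by
    ext w
    rw [rightTr_zpow_apply, lpow, hn]
    exact IsLoop.mul_one' w
  ext x
  rw [← zpow_natCast, ← zpow_mul]
  have h := coe_conjRestrict_zpow X hX a (3 * n) x
  rw [conjMap_zpow, hn, hR] at h
  exact h

theorem extAssumptions_conjRestrict :
    ExtAssumptions (cyclicGen (lpow a 3)) (conjRestrict X hX a ^ 3)
      (assocMap (conjRestrict X hX a)) := by
  have hf := isMoufangPerm_conjRestrict X hX a
  -- For infinite `C` the cardinality is read as `0` and the equation is trivial, so no finiteness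
  -- is needed here.
  have hL : leftTr a ^ (3 * (Nat.card (cyclicSubloop (lpow a 3)) : ℤ)) = 1 := by
    rw [← leftTr_cyclicGen_zpow, zpow_natCast, pow_card_eq_one']
    ext w
    exact IsLoop.one_mul' w
  refine ⟨fun c => Subgroup.mem_zpowers_iff.mpr (exists_cyclicGen_zpow _ c),
    hf.isConstructionPair, fun _ => ?_, fun _ => ?_⟩
  · rw [orderOf_dvd_iff_pow_eq_one, ← zpow_natCast]
    exact conjRestrict_cube_zpow_eq_one X hX a hL
  · refine rParam_dvd hf.biadditive Nat.card_pos fun x y => ?_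
    -- With `m = |C|` this says `x + y = x +_m y`; the correction term, `β` of a partial sum of
    -- length `m` with `y`, must therefore vanish.
    have h := leftTr_zpow_mul_coe X hX a (Nat.card (cyclicSubloop (lpow a 3))) x y
    rw [hL] at h
    have h1 : x + y = transportAdd (conjRestrict X hX a) _ x y := Subtype.ext h
    rw [hf.transportAdd_natCast] at h1
    exact (left_eq_add.mp h1)

end MoufangLoops

/-- The mapping `(c, x) ↦ c * x`. -/
def CyclicExt.toLoop {Q : Type*} [Mul Q] [One Q] [IsMoufangLoop Q] {X : AbelianSubgroup Q} {b₀ : Q}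
    {b : cyclicSubloop b₀} {g : Equiv.Perm X} {γ : X → X → X} (p : CyclicExt b g γ) : Q :=
  (p.fst : Q) * p.snd

/-! ### The loop `M` inside `C × Q`. -/

namespace CyclicExt

variable {Q : Type*} [Mul Q] [One Q] [IsMoufangLoop Q]

/-- Left cancellation recovers `x` from `c` and `c x`. Identities of `M` can thus be checked
separately in `C` and in `Q`. -/
theorem ext_toLoop {X : AbelianSubgroup Q} {b₀ : Q}
    {b : cyclicSubloop b₀} {g : Equiv.Perm X} {γ : X → X → X} {p q : CyclicExt b g γ}
    (h : p.toLoop = q.toLoop) (h1 : p.fst = q.fst) : p = q := by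
  obtain ⟨c, x⟩ := p
  obtain ⟨d, y⟩ := q
  obtain rfl : c = d := h1
  exact CyclicExt.ext rfl (Subtype.ext (loop_left_cancel h))

theorem toLoop_one {X : AbelianSubgroup Q} {b₀ : Q}
    {b : cyclicSubloop b₀} {g : Equiv.Perm X} {γ : X → X → X} :
    (1 : CyclicExt b g γ).toLoop = 1 :=
  IsLoop.one_mul' (1 : Q)

theorem fst_mul {C X : Type*} [Group C] [AddCommGroup X] {b : C} {g : Equiv.Perm X}
    {γ : X → X → X} (p q : CyclicExt b g γ) : (p * q).fst = p.fst * q.fst := rfl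

variable (X : AbelianSubgroup Q) (hX : X.toSubloop.IsNormal) (a : Q)

theorem toLoop_mul_aux (i j : ℤ) (x y : X) :
    toLoop (⟨cyclicGen (lpow a 3) ^ (i + j), extFormula (conjRestrict X hX a ^ 3)
        (assocMap (conjRestrict X hX a)) i j x y⟩ :
      CyclicExt (cyclicGen (lpow a 3)) (conjRestrict X hX a ^ 3)
        (assocMap (conjRestrict X hX a))) =
      ((cyclicGen (lpow a 3) ^ i : cyclicSubloop (lpow a 3)) : Q) * x *
        (((cyclicGen (lpow a 3) ^ j : cyclicSubloop (lpow a 3)) : Q) * y) := by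
  rw [toLoop, cyclicGen_zpow_mul, cyclicGen_zpow_mul, cyclicGen_zpow_mul,
    leftTr_zpow_mul_leftTr_zpow X hX, (isMoufangPerm_conjRestrict X hX a).extFormula_eq,
    ← zpow_natCast, ← zpow_mul]
  congr 6
  push_cast
  ring_nf

theorem toLoop_mul (p q : CyclicExt (cyclicGen (lpow a 3)) (conjRestrict X hX a ^ 3)
    (assocMap (conjRestrict X hX a))) : (p * q).toLoop = p.toLoop * q.toLoop := by
  have h := toLoop_mul_aux X hX a (genExponent (cyclicGen (lpow a 3)) p.fst)
    (genExponent (cyclicGen (lpow a 3)) q.fst) p.snd q.snd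
  rw [zpow_add, genExponent_spec, genExponent_spec] at h
  exact h

/-- The image in `Q` of the formula is the product of the images for every choice of exponents, so
all choices agree in `C × Q`. -/
theorem wellDefined_conjRestrict : WellDefined (cyclicGen (lpow a 3)) (conjRestrict X hX a ^ 3)
    (assocMap (conjRestrict X hX a)) := by
  intro i j x y
  refine ext_toLoop ?_ (zpow_add _ i j).symm
  rw [toLoop_mul, toLoop_mul_aux]
  rfl

/-- A right inverse in `M` makes the translations surjective: the inverse properties of `Q` and `C`
turn it into solutions `q * r` and `r * q`. -/
theorem exists_mul_eq_one (p : CyclicExt (cyclicGen (lpow a 3)) (conjRestrict X hX a ^ 3)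
    (assocMap (conjRestrict X hX a))) : ∃ q, p * q = 1 := by
  obtain ⟨c, x⟩ := p
  obtain ⟨i, rfl⟩ := exists_cyclicGen_zpow _ c
  obtain ⟨y, hy⟩ := exists_transportAdd_eq (conjRestrict X hX a) (i + 2 * -i)
    (((conjRestrict X hX a ^ 3) ^ (- -i)) x) 0
  refine ⟨⟨cyclicGen (lpow a 3) ^ (-i), y⟩, ?_⟩
  rw [wellDefined_conjRestrict, (isMoufangPerm_conjRestrict X hX a).extFormula_eq, hy,
    add_neg_cancel, zpow_zero]
  rfl

theorem isMoufangLoop_conjRestrict :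
    IsMoufangLoop (CyclicExt (cyclicGen (lpow a 3)) (conjRestrict X hX a ^ 3)
      (assocMap (conjRestrict X hX a))) where
  one_mul' p := ext_toLoop (by rw [toLoop_mul, toLoop_one, IsLoop.one_mul']) (one_mul p.fst)
  mul_one' p := ext_toLoop (by rw [toLoop_mul, toLoop_one, IsLoop.mul_one']) (mul_one p.fst)
  left_bijective p := by
    refine ⟨fun q r h => ext_toLoop ?_ ?_, fun r => ?_⟩
    · have h1 := congrArg toLoop h
      simp only [toLoop_mul] at h1
      exact loop_left_cancel h1
    · exact mul_left_cancel (congrArg fst h)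
    · obtain ⟨q, hq⟩ := exists_mul_eq_one X hX a p
      have h1 := congrArg toLoop hq
      rw [toLoop_mul, toLoop_one] at h1
      refine ⟨q * r, ext_toLoop ?_ ?_⟩
      · simp only [toLoop_mul]
        exact loop_mul_inv_mul h1 r.toLoop
      · have h2 : p.fst * q.fst = 1 := congrArg fst hq
        simp only [fst_mul]
        rw [← mul_assoc, h2, one_mul]
  right_bijective p := by
    refine ⟨fun q r h => ext_toLoop ?_ ?_, fun r => ?_⟩
    · have h1 := congrArg toLoop h
      simp only [toLoop_mul] at h1
      exact loop_right_cancel h1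
    · exact mul_right_cancel (congrArg fst h)
    · obtain ⟨q, hq⟩ := exists_mul_eq_one X hX a p
      have h1 := congrArg toLoop hq
      rw [toLoop_mul, toLoop_one] at h1
      refine ⟨r * q, ext_toLoop ?_ ?_⟩
      · simp only [toLoop_mul]
        exact loop_mul_mul_inv (loop_inv_mul h1) r.toLoop
      · have h2 : p.fst * q.fst = 1 := congrArg fst hq
        simp only [fst_mul]
        rw [mul_assoc, mul_eq_one_comm.mp h2, mul_one]
  moufang p q r := by
    refine ext_toLoop ?_ ?_
    · simp only [toLoop_mul]
      exact IsMoufangLoop.moufang _ _ _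
    · simp only [fst_mul, mul_assoc]

end CyclicExt

end Moufang

theorem theorem8p4 {Q : Type*} [Mul Q] [One Q] [IsMoufangLoop Q] (hQ : ThreeDivisible Q)
    (X : AbelianSubgroup Q) (hX : X.toSubloop.IsNormal) (a : Q)
    (ha : a ∈ cyclicSubloop (lpow a 3))
    (hCX : ∀ q : Q, ∃ c ∈ cyclicSubloop (lpow a 3), ∃ x ∈ X, q = c * x)
    (f : Equiv.Perm X) (hf : f = conjRestrict X hX a)
    (β : X → X → X) (hβ : β = assocMap f)
    (b : cyclicSubloop (lpow a 3)) (hb : b = cyclicGen (lpow a 3)) :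
    IsMoufangPerm f ∧
    ExtAssumptions b (f ^ 3) β ∧
    CyclicExt.WellDefined b (f ^ 3) β ∧
    IsMoufangLoop (CyclicExt b (f ^ 3) β) ∧
    ∃ φ : CyclicExt b (f ^ 3) β → Q,
      (∀ (i : ℤ) (x : X), φ ⟨b ^ i, x⟩ = lpow a (3 * i) * x) ∧
      (∀ p q : CyclicExt b (f ^ 3) β, φ (p * q) = φ p * φ q) ∧
      Function.Surjective φ ∧
      {p | φ p = 1} ∩ {p | p.snd = 0} = {1} ∧
      {p | φ p = 1} ∩ {p | p.fst = 1} = {1} := by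
  subst hf hβ hb
  refine ⟨isMoufangPerm_conjRestrict X hX a, extAssumptions_conjRestrict X hX a,
    CyclicExt.wellDefined_conjRestrict X hX a, CyclicExt.isMoufangLoop_conjRestrict X hX a,
    CyclicExt.toLoop, fun i x => ?_, CyclicExt.toLoop_mul X hX a, fun q => ?_, ?_, ?_⟩
  · rw [← leftTr_apply (lpow a (3 * i)), leftTr_lpow]
    exact cyclicGen_zpow_mul a i x
  · obtain ⟨c, hc, x, hx, rfl⟩ := hCX q
    exact ⟨⟨⟨c, hc⟩, ⟨x, hx⟩⟩, rfl⟩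
  · refine Set.eq_singleton_iff_unique_mem.mpr ⟨⟨CyclicExt.toLoop_one, rfl⟩, ?_⟩
    rintro ⟨c, x⟩ ⟨h, hx⟩
    obtain rfl : x = 0 := hx
    have h1 : (c : Q) * 1 = 1 := h
    rw [IsLoop.mul_one'] at h1
    exact CyclicExt.ext (Subtype.ext h1) rfl
  · refine Set.eq_singleton_iff_unique_mem.mpr ⟨⟨CyclicExt.toLoop_one, rfl⟩, ?_⟩
    rintro p ⟨h, h1⟩
    exact CyclicExt.ext_toLoop (Eq.trans h CyclicExt.toLoop_one.symm) h1
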